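/- Let $p$ be a prime, $k$ a field of characteristic $p$, and $K$ an abstract simplicial complex on a finite vertex set $V$ (the empty simplex counts as a face). Let $R=R_K=k[x_i : i\in V]/I_K$ be its Stanley–Reisner ring, where $I_K$ is generated by the square-free monomials $\prod_{i\in\tau}x_i$ with $\tau\notin K$, and let $D(R)=\bigcup_n D^n_k(R)$ be the ring of $k$-linear differential operators on $R$ ($D^0_k(R)=R$, and $D_k^{n+1}(R)=\{\varphi\in\mathrm{End}_k(R) : [\varphi,r]\in D^n_k(R)\text{ for all } r\in R\}$). For a face $\sigma\in K$ write $x_\sigma=\prod_{i\in\sigma}x_i$ and $st(\sigma)=\{\tau\in K : \tau\cup\sigma\in K\}$. For $q=p^r$, $r\ge 0$, let $R^q\subseteq R$ be the $k$-subalgebra generated by the $q$-th powers of elements of $R$ (if $k$ is perfect, this is just the ring of $q$-th powers). Then $R=\bigoplus_L M_L^q$ as an $R^q$-module, where $L$ runs over the distinct stars of faces of $K$ and $M_L^q=\bigoplus_a R^q x^a$, the sum being over the exponent vectors $a$ with all $a_i<q$ whose support is a face of $K$ with star $L$. By means of this decomposition, and since $\mathrm{End}_{R^q}(R)\subseteq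 D(R)$, regard $\mathrm{Hom}_{R^q}(M_L^q,M_{L'}^q)$ as a subset of $D(R)$ (extension by zero on the other summands). Let $J_q(L,L')$ be the two-sided ideal of $D(R)$ generated by $\mathrm{Hom}_{R^q}(M_L^q,M_{L'}^q)$, and put $J(L,L')=\sum_{q} J_q(L,L')$, the sum being over all powers $q=p^r$, $r\geq 0$, and $J(L)=J(L,L)$. Then for every face $\sigma\in K$, $$J(st(\sigma))=\langle x_\sigma\rangle,$$ where $\langle x_\sigma\rangle$ is the two-sided ideal of $D(R)$ generated by multiplication by $x_\sigma$. -/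

import Mathlib

namespace StanleyReisner

noncomputable section

/-! ### Simplicial complexes, stars and face rings -/

/-- The faces of a finite simplicial complex, the empty simplex included
(`PreAbstractSimplicialComplex` only records the non-empty ones). -/
def IsFace {V : Type*} (K : PreAbstractSimplicialComplex V) (σ : Finset V) : Prop :=
  σ = ∅ ∨ σ ∈ K

/-- The closed star `st(σ) = {τ ∈ K | τ ∪ σ ∈ K}`. -/
def star {V : Type*} [DecidableEq V] (K : PreAbstractSimplicialComplex V) (σ : Finset V) :
    Set (Finset V) :=
  {τ | IsFace K τ ∧ IsFace K (τ ∪ σ)}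

/-- The face ideal `I_K`, generated by the square-free monomials of the non-faces of `K`. -/
def faceIdeal {V : Type*} (k : Type*) [CommRing k] (K : PreAbstractSimplicialComplex V) :
    Ideal (MvPolynomial V k) :=
  Ideal.span {f | ∃ τ : Finset V, ¬ IsFace K τ ∧ f = ∏ i ∈ τ, MvPolynomial.X i}

/-- The Stanley-Reisner ring (face ring) `R_K = k[x_i | i ∈ V] / I_K`. -/
abbrev FaceRing {V : Type*} (k : Type*) [CommRing k] (K : PreAbstractSimplicialComplex V) : Type _ :=
  MvPolynomial V k ⧸ faceIdeal k K

/-- The class of the monomial `x^a` in the face ring. -/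
def mono {V : Type*} (k : Type*) [CommRing k] (K : PreAbstractSimplicialComplex V) (a : V →₀ ℕ) :
    FaceRing k K :=
  Ideal.Quotient.mk (faceIdeal k K) (MvPolynomial.monomial a 1)

/-- The class of `x_σ = ∏_{i ∈ σ} x_i` in the face ring. -/
def xFace {V : Type*} (k : Type*) [CommRing k] (K : PreAbstractSimplicialComplex V) (σ : Finset V) :
    FaceRing k K :=
  Ideal.Quotient.mk (faceIdeal k K) (∏ i ∈ σ, MvPolynomial.X i)

/-! ### Differential operators -/

/-- `D_k^n(R)`: `D_k^0(R)` is `R`, acting on itself by multiplication, and `D_k^{n+1}(R)` consists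
of the `k`-linear endomorphisms `φ` with `[φ, r] ∈ D_k^n(R)` for all `r ∈ R`. -/
def diffOpOfOrder (k R : Type*) [CommRing k] [CommRing R] [Algebra k R] :
    ℕ → Submodule k (Module.End k R)
  | 0 => Subalgebra.toSubmodule (Algebra.lmul k R).range
  | n + 1 =>
    { carrier := {φ | ∀ r : R, φ * Algebra.lmul k R r - Algebra.lmul k R r * φ ∈
        diffOpOfOrder k R n}
      add_mem' := by
        intro φ ψ hφ hψ r
        have h := add_mem (hφ r) (hψ r)
        convert h using 1
        rw [add_mul, mul_add]
        abel
      zero_mem' := by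
        intro r
        simp
      smul_mem' := by
        intro c φ hφ r
        have h := Submodule.smul_mem _ c (hφ r)
        convert h using 1
        rw [smul_sub, smul_mul_assoc, mul_smul_comm] }

theorem lmul_mem_diffOpOfOrder (k R : Type*) [CommRing k] [CommRing R] [Algebra k R] (r : R)
    (n : ℕ) : Algebra.lmul k R r ∈ diffOpOfOrder k R n := by
  induction n with
  | zero => exact ⟨r, rfl⟩
  | succ n _ =>
    intro s
    rw [← map_mul, ← map_mul, mul_comm, sub_self]
    exact zero_mem _

theorem diffOpOfOrder_le_succ (k R : Type*) [CommRing k] [CommRing R] [Algebra k R] (n : ℕ) :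
    diffOpOfOrder k R n ≤ diffOpOfOrder k R (n + 1) := by
  induction n with
  | zero =>
    rintro _ ⟨r, rfl⟩
    exact lmul_mem_diffOpOfOrder k R r 1
  | succ n ih => exact fun φ hφ r => ih (hφ r)

theorem diffOpOfOrder_mono (k R : Type*) [CommRing k] [CommRing R] [Algebra k R] :
    Monotone (diffOpOfOrder k R) :=
  monotone_nat_of_le_succ (diffOpOfOrder_le_succ k R)

theorem mul_mem_diffOpOfOrder (k R : Type*) [CommRing k] [CommRing R] [Algebra k R] (N : ℕ) :
    ∀ m n : ℕ, m + n = N → ∀ φ ∈ diffOpOfOrder k R m, ∀ ψ ∈ diffOpOfOrder k R n,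
      φ * ψ ∈ diffOpOfOrder k R N := by
  induction N with
  | zero =>
    intro m n h φ hφ ψ hψ
    obtain ⟨rfl, rfl⟩ : m = 0 ∧ n = 0 := by omega
    exact (Algebra.lmul k R).range.mul_mem hφ hψ
  | succ N ih =>
    intro m n h φ hφ ψ hψ r
    have e : φ * ψ * Algebra.lmul k R r - Algebra.lmul k R r * (φ * ψ) =
        φ * (ψ * Algebra.lmul k R r - Algebra.lmul k R r * ψ) +
          (φ * Algebra.lmul k R r - Algebra.lmul k R r * φ) * ψ := by
      simp only [mul_sub, sub_mul, mul_assoc]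
      abel
    rw [e]
    refine add_mem ?_ ?_
    · cases n with
      | zero =>
        obtain ⟨s, rfl⟩ := hψ
        have e0 : (Algebra.lmul k R).toRingHom s * Algebra.lmul k R r -
            Algebra.lmul k R r * (Algebra.lmul k R).toRingHom s = 0 := by
          change Algebra.lmul k R s * Algebra.lmul k R r -
            Algebra.lmul k R r * Algebra.lmul k R s = 0
          rw [← map_mul, ← map_mul, mul_comm, sub_self]
        rw [e0, mul_zero]
        exact zero_mem _
      | succ n => exact ih m n (by omega) φ hφ _ (hψ r)
    · cases m with
      | zero =>
        obtain ⟨s, rfl⟩ := hφ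
        have e0 : (Algebra.lmul k R).toRingHom s * Algebra.lmul k R r -
            Algebra.lmul k R r * (Algebra.lmul k R).toRingHom s = 0 := by
          change Algebra.lmul k R s * Algebra.lmul k R r -
            Algebra.lmul k R r * Algebra.lmul k R s = 0
          rw [← map_mul, ← map_mul, mul_comm, sub_self]
        rw [e0, zero_mul]
        exact zero_mem _
      | succ m => exact ih m n (by omega) _ (hφ r) ψ hψ

/-- The ring `D_k(R) = ⋃_n D_k^n(R)` of `k`-linear differential operators on `R`. -/
def diffOps (k R : Type*) [CommRing k] [CommRing R] [Algebra k R] :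
    Subalgebra k (Module.End k R) where
  carrier := {φ | ∃ n : ℕ, φ ∈ diffOpOfOrder k R n}
  mul_mem' := by
    rintro φ ψ ⟨m, hφ⟩ ⟨n, hψ⟩
    exact ⟨m + n, mul_mem_diffOpOfOrder k R _ m n rfl φ hφ ψ hψ⟩
  add_mem' := by
    rintro φ ψ ⟨m, hφ⟩ ⟨n, hψ⟩
    exact ⟨max m n, add_mem (diffOpOfOrder_mono k R (le_max_left m n) hφ)
      (diffOpOfOrder_mono k R (le_max_right m n) hψ)⟩
  algebraMap_mem' := by
    intro c
    refine ⟨0, algebraMap k R c, ?_⟩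
    exact AlgHom.commutes (Algebra.lmul k R) c

/-- The inclusion `R = D_k^0(R) ⊆ D_k(R)`: an element of `R` acting by multiplication. -/
def mulOp (k : Type*) {R : Type*} [CommRing k] [CommRing R] [Algebra k R] (r : R) :
    diffOps k R :=
  ⟨Algebra.lmul k R r, 0, lmul_mem_diffOpOfOrder k R r 0⟩

/-! ### Rings of `q`-th powers -/

/-- The ring `R^q`: the `k`-subalgebra of `R` generated by the `q`-th powers of its elements. If `k`
is perfect of characteristic `p` and `q` is a power of `p`, it is the set of `q`-th powers:
see `coe_powSubalgebra`. -/
def powSubalgebra (k R : Type*) [CommRing k] [CommRing R] [Algebra k R] (q : ℕ) :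
    Subalgebra k R :=
  Algebra.adjoin k (Set.range fun f : R => f ^ q)

theorem coe_powSubalgebra (k R : Type*) [Field k] [CommRing R] [Algebra k R] (p r : ℕ)
    [Fact p.Prime] [CharP k p] [PerfectRing k p] :
    (powSubalgebra k R (p ^ r) : Set R) = Set.range fun f : R => f ^ p ^ r := by
  have hadd : ∀ a b : R, (a + b) ^ p ^ r = a ^ p ^ r + b ^ p ^ r := by
    intro a b
    obtain h | h := subsingleton_or_nontrivial R
    · exact Subsingleton.elim _ _
    · have : CharP R p := charP_of_injective_algebraMap (algebraMap k R).injective p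
      exact add_pow_char_pow a b p r
  refine Set.Subset.antisymm ?_ Algebra.subset_adjoin
  intro x hx
  refine Algebra.adjoin_induction (p := fun x _ => x ∈ Set.range fun f : R => f ^ p ^ r)
    ?_ ?_ ?_ ?_ hx
  · exact fun x h => h
  · intro c
    obtain ⟨d, hd⟩ := (bijective_iterateFrobenius k p r).2 c
    refine ⟨algebraMap k R d, ?_⟩
    rw [← hd, iterateFrobenius_def, map_pow]
  · rintro _ _ _ _ ⟨a, rfl⟩ ⟨b, rfl⟩
    exact ⟨a + b, hadd a b⟩
  · rintro _ _ _ _ ⟨a, rfl⟩ ⟨b, rfl⟩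
    exact ⟨a * b, mul_pow a b _⟩

/-! ### The Frobenius decomposition and the ideals `J` -/

/-- The summand `M_L^q` of `R = ⨁_L M_L^q`, where `L` runs over the stars of `K`: the direct sum of
the `R^q`-modules `R^q · x^a` over the monomials `x^a` with all exponents `< q` and with support a
face whose star is `L`. -/
def frobSummand {V : Type*} [DecidableEq V] (k : Type*) [CommRing k]
    (K : PreAbstractSimplicialComplex V) (q : ℕ) (L : Set (Finset V)) :
    Submodule (powSubalgebra k (FaceRing k K) q) (FaceRing k K) :=
  Submodule.span _ {f | ∃ a : V →₀ ℕ, (∀ i, a i < q) ∧ IsFace K a.support ∧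
    star K a.support = L ∧ f = mono k K a}

/-- `Hom_{R^q}(M_L^q, M_{L'}^q)` as a part of `End_{R^q}(R)`: an endomorphism of `R` belongs to it
if, for some `R^q`-linear `ψ : M_L^q → M_{L'}^q`, it is `ψ` on `M_L^q` and zero on all the other
summands of `R`. -/
def frobHom {V : Type*} [DecidableEq V] (k : Type*) [CommRing k]
    (K : PreAbstractSimplicialComplex V) (q : ℕ) (L L' : Set (Finset V)) :
    Set (Module.End (powSubalgebra k (FaceRing k K) q) (FaceRing k K)) :=
  {φ | (∃ ψ : frobSummand k K q L →ₗ[powSubalgebra k (FaceRing k K) q] frobSummand k K q L',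
      ∀ f : frobSummand k K q L, φ f = ψ f) ∧
    ∀ τ : Finset V, IsFace K τ → star K τ ≠ L → ∀ f ∈ frobSummand k K q (star K τ), φ f = 0}

/-- `J_q(L, L')`: the two-sided ideal of `D(R)` generated by the elements of
`Hom_{R^q}(M_L^q, M_{L'}^q)`. If `k` is a field of characteristic `p > 0` and `q` a power of `p`,
then all elements of `End_{R^q}(R)` are differential operators: see `restrictScalars_mem_diffOps`. -/
def frobIdealAt {V : Type*} [DecidableEq V] (k : Type*) [CommRing k]
    (K : PreAbstractSimplicialComplex V) (q : ℕ) (L L' : Set (Finset V)) :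
    TwoSidedIdeal (diffOps k (FaceRing k K)) :=
  TwoSidedIdeal.span {d | ∃ φ ∈ frobHom k K q L L',
    (d : Module.End k (FaceRing k K)) = LinearMap.restrictScalars k φ}

/-- `J(L, L') = ∑_q J_q(L, L')`, where `q` runs over the powers of `p`. -/
def frobIdeal₂ {V : Type*} [DecidableEq V] (k : Type*) [CommRing k]
    (K : PreAbstractSimplicialComplex V) (p : ℕ) (L L' : Set (Finset V)) :
    TwoSidedIdeal (diffOps k (FaceRing k K)) :=
  ⨆ r : ℕ, frobIdealAt k K (p ^ r) L L'

/-- `J(L) = J(L, L)`. -/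
def frobIdeal {V : Type*} [DecidableEq V] (k : Type*) [CommRing k]
    (K : PreAbstractSimplicialComplex V) (p : ℕ) (L : Set (Finset V)) :
    TwoSidedIdeal (diffOps k (FaceRing k K)) :=
  frobIdeal₂ k K p L L

/-! ### `R^q`-linear endomorphisms of `R` are differential operators -/

theorem mem_diffOpOfOrder_succ_of_X {V : Type*} (k : Type*) [CommRing k]
    (K : PreAbstractSimplicialComplex V) (n : ℕ) (φ : Module.End k (FaceRing k K))
    (h : ∀ i : V, φ * Algebra.lmul k _ (Ideal.Quotient.mk (faceIdeal k K) (MvPolynomial.X i)) -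
      Algebra.lmul k _ (Ideal.Quotient.mk (faceIdeal k K) (MvPolynomial.X i)) * φ ∈
        diffOpOfOrder k (FaceRing k K) n) :
    φ ∈ diffOpOfOrder k (FaceRing k K) (n + 1) := by
  intro r
  obtain ⟨f, rfl⟩ := Ideal.Quotient.mk_surjective r
  induction f using MvPolynomial.induction_on with
  | C c =>
    have e : Algebra.lmul k (FaceRing k K) (Ideal.Quotient.mk (faceIdeal k K) (MvPolynomial.C c)) =
        algebraMap k _ c := AlgHom.commutes (Algebra.lmul k (FaceRing k K)) c
    rw [e, Algebra.commutes, sub_self]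
    exact zero_mem _
  | add f g hf hg =>
    convert add_mem hf hg using 1
    rw [map_add, map_add, mul_add, add_mul]
    abel
  | mul_X f i hf =>
    have h1 := mul_mem_diffOpOfOrder k _ n n 0 rfl _ hf _ (lmul_mem_diffOpOfOrder k (FaceRing k K)
      (Ideal.Quotient.mk (faceIdeal k K) (MvPolynomial.X i)) 0)
    have h2 := mul_mem_diffOpOfOrder k _ n 0 n (zero_add n) _ (lmul_mem_diffOpOfOrder k
      (FaceRing k K) (Ideal.Quotient.mk (faceIdeal k K) f) 0) _ (h i)
    convert add_mem h1 h2 using 1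
    rw [map_mul, map_mul]
    simp only [mul_sub, sub_mul, mul_assoc]
    abel

theorem mem_diffOps_of_ad_pow {V : Type*} [Fintype V] (k : Type*) [CommRing k]
    (K : PreAbstractSimplicialComplex V) (N : ℕ) :
    ∀ (m : V → ℕ), ∑ i, m i = N → ∀ φ : Module.End k (FaceRing k K),
      (∀ i, ((LinearMap.mulRight k (Algebra.lmul k (FaceRing k K)
          (Ideal.Quotient.mk (faceIdeal k K) (MvPolynomial.X i))) -
        LinearMap.mulLeft k (Algebra.lmul k (FaceRing k K)
          (Ideal.Quotient.mk (faceIdeal k K) (MvPolynomial.X i)))) ^ m i) φ = 0) →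
      φ ∈ diffOpOfOrder k (FaceRing k K) (N + 1) := by
  classical
  have hc : ∀ i j : V, Commute
      (LinearMap.mulRight k (Algebra.lmul k (FaceRing k K)
          (Ideal.Quotient.mk (faceIdeal k K) (MvPolynomial.X i))) -
        LinearMap.mulLeft k (Algebra.lmul k (FaceRing k K)
          (Ideal.Quotient.mk (faceIdeal k K) (MvPolynomial.X i))))
      (LinearMap.mulRight k (Algebra.lmul k (FaceRing k K)
          (Ideal.Quotient.mk (faceIdeal k K) (MvPolynomial.X j))) -
        LinearMap.mulLeft k (Algebra.lmul k (FaceRing k K)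
          (Ideal.Quotient.mk (faceIdeal k K) (MvPolynomial.X j)))) := by
    intro i j
    have hx : Commute
        (Algebra.lmul k (FaceRing k K) (Ideal.Quotient.mk (faceIdeal k K) (MvPolynomial.X i)))
        (Algebra.lmul k (FaceRing k K) (Ideal.Quotient.mk (faceIdeal k K) (MvPolynomial.X j))) :=
      (Commute.all _ _).map (Algebra.lmul k (FaceRing k K))
    refine LinearMap.ext fun φ => ?_
    simp only [Module.End.mul_apply, LinearMap.sub_apply, LinearMap.mulRight_apply,
      LinearMap.mulLeft_apply, mul_sub, sub_mul, mul_assoc, hx.eq]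
    rw [← mul_assoc, ← mul_assoc _ _ φ, hx.eq]
    abel
  induction N with
  | zero =>
    intro m hm φ hφ
    refine mem_diffOpOfOrder_succ_of_X k K 0 φ fun i => ?_
    have hi : m i = 0 := (Finset.sum_eq_zero_iff.1 hm) i (Finset.mem_univ i)
    have h0 : φ = 0 := by simpa [hi] using hφ i
    simp [h0]
  | succ N ih =>
    intro m hm φ hφ
    refine mem_diffOpOfOrder_succ_of_X k K (N + 1) φ fun i => ?_
    by_cases hi : m i = 0
    · have h0 : φ = 0 := by simpa [hi] using hφ i
      simp [h0]
    · have hs : ∑ j, Function.update m i (m i - 1) j = N := by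
        rw [Finset.sum_update_of_mem (Finset.mem_univ i)]
        rw [← Finset.add_sum_erase _ _ (Finset.mem_univ i)] at hm
        rw [Finset.sdiff_singleton_eq_erase]
        omega
      refine ih _ hs _ fun j => ?_
      by_cases hj : j = i
      · subst hj
        rw [Function.update_self]
        have h1 := hφ j
        rw [← Nat.sub_add_cancel (Nat.one_le_iff_ne_zero.2 hi), pow_succ] at h1
        exact h1
      · rw [Function.update_of_ne hj]
        have h1 := ((hc j i).pow_left (m j)).eq
        have h2 := LinearMap.congr_fun h1 φ
        rw [Module.End.mul_apply, Module.End.mul_apply, hφ j, map_zero] at h2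
        exact h2

theorem ad_pow_apply (k E : Type*) [Field k] [Ring E] [Algebra k E] (p r : ℕ)
    [Fact p.Prime] [CharP k p] (x φ : E) :
    ((LinearMap.mulRight k x - LinearMap.mulLeft k x) ^ p ^ r) φ =
      φ * x ^ p ^ r - x ^ p ^ r * φ := by
  set A : Module.End k E := LinearMap.mulRight k x with hA
  set B : Module.End k E := LinearMap.mulLeft k x with hB
  have hAB : Commute (A - B) B := by
    refine Commute.sub_left ?_ (Commute.refl B)
    refine LinearMap.ext fun ψ => ?_
    simp [hA, hB, mul_assoc]
  have h := hAB.add_pow_prime_pow_eq (Fact.out : p.Prime) r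
  have h0 : ((p : ℕ) : Module.End k E) = 0 := by
    rw [← map_natCast (algebraMap k (Module.End k E)), CharP.cast_eq_zero, map_zero]
  rw [sub_add_cancel, h0, zero_mul, zero_mul, zero_mul, add_zero] at h
  rw [eq_sub_iff_add_eq.2 h.symm, hA, hB, LinearMap.pow_mulLeft, LinearMap.pow_mulRight,
    LinearMap.sub_apply, LinearMap.mulRight_apply, LinearMap.mulLeft_apply]

theorem restrictScalars_mem_diffOps {V : Type*} [Finite V] (k : Type*) [Field k] (p r : ℕ)
    [Fact p.Prime] [CharP k p] (K : PreAbstractSimplicialComplex V)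
    (φ : Module.End (powSubalgebra k (FaceRing k K) (p ^ r)) (FaceRing k K)) :
    LinearMap.restrictScalars k φ ∈ diffOps k (FaceRing k K) := by
  have := Fintype.ofFinite V
  refine ⟨_, mem_diffOps_of_ad_pow k K _ (fun _ => p ^ r) rfl _ fun i => ?_⟩
  refine (ad_pow_apply k (Module.End k (FaceRing k K)) p r _ _).trans ?_
  rw [sub_eq_zero, ← map_pow]
  generalize Ideal.Quotient.mk (faceIdeal k K) (MvPolynomial.X i) = x
  refine LinearMap.ext fun f => ?_
  exact φ.map_smul (⟨x ^ p ^ r, Algebra.subset_adjoin ⟨x, rfl⟩⟩ :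
    powSubalgebra k (FaceRing k K) (p ^ r)) f

end

end StanleyReisner

namespace StanleyReisner

noncomputable section

open MvPolynomial

variable {V : Type*} {k : Type*} {K : PreAbstractSimplicialComplex V}

/-! The elementary operators `shiftOp` send `x^{a+qn}` to `x^{b+qn}` and kill every other monomial.
Such an operator is well defined on the face ring once every `ρ` that forms a face with `supp b`
also forms one with `supp a`. If moreover all `a_i < q`, it is `R^q`-linear, hence a differential
operator (`shiftOp_mem_diffOps`). Since `R` splits into finitely many components spanned by the
`x^{a+qn}` with `a` reduced modulo `q`, membership in a two-sided ideal can be tested one component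
at a time (`mem_of_forall_component`).

For `⟨x_σ⟩ ⊆ J(st σ)`: on each component modulo `p^2`, multiplication by `x_σ` factors through the
projection onto `R^p x_σ`, which lies in `Hom(M_L^p, M_L^p)` with `L = st(σ)`.

For `J(st σ) ⊆ ⟨x_σ⟩`: let `φ` be a generator at level `q`. It vanishes on the components whose
residue modulo `q` does not have star `st(σ)`. On the others, adjoining `σ` to the supports involved
loses no faces, so multiplication by `x_σ` can be undone by an elementary operator, and `φ` factors
through `x_σ`. -/

theorem IsFace.mono {σ τ : Finset V} (h : IsFace K σ) (hτ : τ ⊆ σ) : IsFace K τ := by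
  rcases τ.eq_empty_or_nonempty with rfl | hne
  · exact Or.inl rfl
  · rcases h with rfl | h
    · exact absurd (Finset.subset_empty.1 hτ) hne.ne_empty
    · exact Or.inr ((K.isRelLowerSet_faces h).2 hτ hne)

/-- If `st(τ) = st(σ)`, then adjoining `σ` to a face containing `τ` again gives a face. -/
theorem isFace_union_of_star_eq [DecidableEq V] {σ τ ρ : Finset V} (h : star K τ = star K σ) (hτ : τ ⊆ ρ)
    (hρ : IsFace K ρ) : IsFace K (ρ ∪ σ) := by
  have h1 : ρ ∈ star K τ := ⟨hρ, by rwa [Finset.union_eq_left.2 hτ]⟩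
  rw [h] at h1
  exact h1.2

/-! ### Monomials of the face ring -/

/-- The exponent vector of the square-free monomial `x_σ`. -/
def faceExp (σ : Finset V) : V →₀ ℕ :=
  ∑ i ∈ σ, Finsupp.single i 1

theorem faceExp_apply [DecidableEq V] (σ : Finset V) (i : V) : faceExp σ i = if i ∈ σ then 1 else 0 := by
  simp [faceExp, Finsupp.finsetSum_apply, Finsupp.single_apply]

@[simp]
theorem support_faceExp [DecidableEq V] (σ : Finset V) : (faceExp σ).support = σ := by
  ext i
  simp [faceExp_apply]

theorem faceExp_le_one [DecidableEq V] (σ : Finset V) (i : V) : faceExp σ i ≤ 1 := by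
  rw [faceExp_apply]
  split_ifs <;> simp

theorem support_add [DecidableEq V] (a b : V →₀ ℕ) : (a + b).support = a.support ∪ b.support := by
  ext i
  simp only [Finsupp.mem_support_iff, Finsupp.add_apply, Finset.mem_union]
  omega

theorem support_smul {q : ℕ} (hq : q ≠ 0) (n : V →₀ ℕ) : (q • n).support = n.support := by
  ext i
  simp [hq]

section CommRing

variable [CommRing k]

theorem xFace_eq_mono (σ : Finset V) : xFace k K σ = mono k K (faceExp σ) := by
  rw [xFace, mono, faceExp, monomial_sum_one]
  rfl

theorem mono_add (a b : V →₀ ℕ) : mono k K (a + b) = mono k K a * mono k K b := by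
  rw [mono, mono, mono, ← map_mul, monomial_mul, one_mul]

theorem mono_smul (q : ℕ) (a : V →₀ ℕ) : mono k K (q • a) = mono k K a ^ q := by
  rw [mono, mono, ← map_pow, monomial_pow, one_pow]

theorem mono_eq_zero {a : V →₀ ℕ} (h : ¬ IsFace K a.support) : mono k K a = 0 := by
  classical
  have e : a = (a - faceExp a.support) + faceExp a.support := by
    ext i
    have : faceExp a.support i ≤ a i := by
      rw [faceExp_apply]
      split_ifs with hi
      · exact Nat.one_le_iff_ne_zero.2 (Finsupp.mem_support_iff.1 hi)
      · exact Nat.zero_le _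
    simp only [Finsupp.add_apply, Finsupp.tsub_apply]
    omega
  rw [e, mono_add, ← xFace_eq_mono]
  refine mul_eq_zero_of_right _ (Ideal.Quotient.eq_zero_iff_mem.2 (Ideal.subset_span ?_))
  exact ⟨_, h, rfl⟩

theorem linearMap_ext_mono {M : Type*} [AddCommGroup M] [Module k M] {φ ψ : FaceRing k K →ₗ[k] M}
    (h : ∀ a, φ (mono k K a) = ψ (mono k K a)) : φ = ψ := by
  refine LinearMap.ext fun f => ?_
  obtain ⟨f, rfl⟩ := Ideal.Quotient.mk_surjective f
  have e : φ ∘ₗ (Ideal.Quotient.mkₐ k (faceIdeal k K)).toLinearMap =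
      ψ ∘ₗ (Ideal.Quotient.mkₐ k (faceIdeal k K)).toLinearMap :=
    (MvPolynomial.basisMonomials V k).ext fun a => by
      rw [coe_basisMonomials]
      exact h a
  exact LinearMap.congr_fun e f

/-! ### Elementary operators -/

open Classical in
/-- The `k`-linear map `k[x] → R` sending `x^{a + q n}` to `x^{b + q n}` and the other monomials
to `0`. -/
def polyShift (k : Type*) [CommRing k] (K : PreAbstractSimplicialComplex V) (q : ℕ)
    (a b : V →₀ ℕ) : MvPolynomial V k →ₗ[k] FaceRing k K :=
  (MvPolynomial.basisMonomials V k).constr k fun m =>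
    if ∃ n : V →₀ ℕ, m = a + q • n then mono k K (m - a + b) else 0

theorem polyShift_add_smul (q : ℕ) (a b n : V →₀ ℕ) :
    polyShift k K q a b (monomial (a + q • n) 1) = mono k K (b + q • n) := by
  have h := (MvPolynomial.basisMonomials V k).constr_basis k (fun m =>
    open Classical in
    if ∃ n : V →₀ ℕ, m = a + q • n then mono k K (m - a + b) else 0) (a + q • n)
  rw [coe_basisMonomials, if_pos ⟨n, rfl⟩, add_tsub_cancel_left, add_comm (q • n) b] at h
  exact h

theorem polyShift_of_forall_ne {q : ℕ} {a m : V →₀ ℕ} (b : V →₀ ℕ)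
    (h : ∀ n : V →₀ ℕ, m ≠ a + q • n) : polyShift k K q a b (monomial m 1) = 0 := by
  have h' := (MvPolynomial.basisMonomials V k).constr_basis k (fun m =>
    open Classical in
    if ∃ n : V →₀ ℕ, m = a + q • n then mono k K (m - a + b) else 0) m
  rw [coe_basisMonomials, if_neg (fun ⟨n, hn⟩ => h n hn)] at h'
  exact h'

/-- If `x^{a+ql}` is divisible by `x_τ` with `τ` a non-face, then `supp a ∪ supp l` is a non-face,
so by `hab` the target `x^{b+ql}` is zero as well. -/
theorem polyShift_eq_zero_of_mem [DecidableEq V] {q : ℕ} (hq : q ≠ 0) {a b : V →₀ ℕ}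
    (hab : ∀ ρ : Finset V, IsFace K (b.support ∪ ρ) → IsFace K (a.support ∪ ρ))
    {f : MvPolynomial V k} (hf : f ∈ faceIdeal k K) : polyShift k K q a b f = 0 := by
  -- `polyShift` is only `k`-linear, so the induction over the ideal must carry all polynomial
  -- multiples of `f`.
  suffices h : ∀ g : MvPolynomial V k, polyShift k K q a b (g * f) = 0 by simpa using h 1
  induction hf using Submodule.span_induction with
  | mem f hf =>
    obtain ⟨τ, hτ, rfl⟩ := hf
    have e : (∏ i ∈ τ, X i : MvPolynomial V k) = monomial (faceExp τ) 1 := by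
      rw [faceExp, monomial_sum_one]
      rfl
    intro g
    rw [e]
    induction g using MvPolynomial.induction_on' with
    | monomial n c =>
      have e' : monomial n c * monomial (faceExp τ) (1 : k) = c • monomial (n + faceExp τ) 1 := by
        rw [monomial_mul, smul_monomial, smul_eq_mul]
      rw [e', map_smul]
      by_cases h : ∃ l : V →₀ ℕ, n + faceExp τ = a + q • l
      · obtain ⟨l, hl⟩ := h
        rw [hl, polyShift_add_smul, mono_eq_zero, smul_zero]
        rw [support_add, support_smul hq]
        intro hb
        refine hτ ((hab _ hb).mono ?_)
        rw [← support_smul hq l, ← support_add, ← hl, support_add, support_faceExp]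
        exact Finset.subset_union_right
      · rw [polyShift_of_forall_ne b (not_exists.1 h), smul_zero]
    | add g g' h h' => rw [add_mul, map_add, h, h', add_zero]
  | zero => simp
  | add f f' _ _ h h' =>
    intro g
    rw [mul_add, map_add, h, h', add_zero]
  | smul c f _ h =>
    intro g
    rw [smul_eq_mul, ← mul_assoc]
    exact h _

variable [DecidableEq V]

/-- The operator on `R` sending `x^{a + q n}` to `x^{b + q n}` and the other monomials to `0`; it
exists as soon as the annihilator of `x^a` over the `q`-th powers kills `x^b`. -/
def shiftOp (k : Type*) [CommRing k] {K : PreAbstractSimplicialComplex V} {q : ℕ} (hq : q ≠ 0)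
    {a b : V →₀ ℕ} (hab : ∀ ρ : Finset V, IsFace K (b.support ∪ ρ) → IsFace K (a.support ∪ ρ)) :
    Module.End k (FaceRing k K) :=
  ((faceIdeal k K).restrictScalars k).liftQ (polyShift k K q a b)
      (fun _ hf => polyShift_eq_zero_of_mem hq hab hf) ∘ₗ
    (Submodule.Quotient.restrictScalarsEquiv k (faceIdeal k K)).symm.toLinearMap

section shiftOp

variable {q : ℕ} (hq : q ≠ 0) {a b : V →₀ ℕ}
  (hab : ∀ ρ : Finset V, IsFace K (b.support ∪ ρ) → IsFace K (a.support ∪ ρ))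

theorem shiftOp_add_smul (n : V →₀ ℕ) :
    shiftOp k hq hab (mono k K (a + q • n)) = mono k K (b + q • n) :=
  polyShift_add_smul q a b n

theorem shiftOp_of_forall_ne {m : V →₀ ℕ} (h : ∀ n : V →₀ ℕ, m ≠ a + q • n) :
    shiftOp k hq hab (mono k K m) = 0 :=
  polyShift_of_forall_ne b h

/-- Multiplication by `x^{qn}` preserves residues of exponents modulo `q`. As `a` is reduced, the
exponents `a + q l` fill a whole residue class, so a monomial killed by the shift stays killed after
this multiplication. -/
theorem shiftOp_mul_lmul (ha : ∀ i, a i < q) (n : V →₀ ℕ) :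
    shiftOp k hq hab * Algebra.lmul k _ (mono k K (q • n)) =
      Algebra.lmul k _ (mono k K (q • n)) * shiftOp k hq hab := by
  refine linearMap_ext_mono fun m => ?_
  change shiftOp k hq hab (mono k K (q • n) * mono k K m) =
    mono k K (q • n) * shiftOp k hq hab (mono k K m)
  rw [← mono_add]
  by_cases h : ∃ l : V →₀ ℕ, m = a + q • l
  · obtain ⟨l, rfl⟩ := h
    rw [shiftOp_add_smul, ← mono_add, add_left_comm, ← smul_add, shiftOp_add_smul, smul_add,
      add_left_comm]
  · rw [shiftOp_of_forall_ne hq hab (not_exists.1 h), mul_zero]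
    refine shiftOp_of_forall_ne hq hab fun l hl => h ⟨l - n, ?_⟩
    ext i
    have h1 := DFunLike.congr_fun hl i
    have h2 := ha i
    simp only [Finsupp.add_apply, Finsupp.smul_apply, smul_eq_mul, Finsupp.tsub_apply] at h1 ⊢
    -- From `q n_i ≤ a_i + q l_i < q (l_i + 1)`.
    have h3 : n i ≤ l i := by
      by_contra! h3
      have : q * (l i + 1) ≤ q * n i := Nat.mul_le_mul_left q h3
      rw [mul_add, mul_one] at this
      omega
    rw [Nat.mul_sub]
    have : q * n i ≤ q * l i := Nat.mul_le_mul_left q h3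
    omega

end shiftOp

end CommRing

/-! ### Linearity over the `q`-th powers -/

section CharP

variable [Field k] {p r : ℕ} [Fact p.Prime] [CharP k p]

theorem add_pow_prime_pow (f g : FaceRing k K) :
    (f + g) ^ p ^ r = f ^ p ^ r + g ^ p ^ r := by
  obtain h | h := subsingleton_or_nontrivial (FaceRing k K)
  · exact Subsingleton.elim _ _
  · have : CharP (FaceRing k K) p :=
      charP_of_injective_algebraMap (algebraMap k (FaceRing k K)).injective p
    exact add_pow_char_pow f g p r

/-- Frobenius is additive, so the `q`-th power of `∑ c_n x^n` is `∑ c_n^q x^{qn}`. Hence the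
monomials `x^{qn}` generate `R^q` over `k`, whether or not `k` is perfect. -/
theorem map_powSubalgebra_mul {φ : Module.End k (FaceRing k K)}
    (h : ∀ n : V →₀ ℕ, φ * Algebra.lmul k _ (mono k K (p ^ r • n)) =
      Algebra.lmul k _ (mono k K (p ^ r • n)) * φ)
    {c : FaceRing k K} (hc : c ∈ powSubalgebra k (FaceRing k K) (p ^ r)) (f : FaceRing k K) :
    φ (c * f) = c * φ f := by
  induction hc using Algebra.adjoin_induction generalizing f with
  | mem c hc =>
    obtain ⟨g, rfl⟩ := hc
    obtain ⟨g, rfl⟩ := Ideal.Quotient.mk_surjective g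
    dsimp only
    induction g using MvPolynomial.induction_on' generalizing f with
    | monomial n c =>
      have e : Ideal.Quotient.mk (faceIdeal k K) (monomial n c) ^ p ^ r =
          c ^ p ^ r • mono k K (p ^ r • n) := by
        have e' : monomial (p ^ r • n) (c ^ p ^ r) =
            c ^ p ^ r • (monomial (p ^ r • n) 1 : MvPolynomial V k) := by
          rw [smul_monomial, smul_eq_mul, mul_one]
        rw [← map_pow, monomial_pow, e']
        rfl
      rw [e, smul_mul_assoc, smul_mul_assoc, map_smul]
      exact congrArg _ (LinearMap.congr_fun (h n) f)
    | add g g' hg hg' =>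
      rw [map_add, add_pow_prime_pow, add_mul, add_mul, map_add, hg, hg']
  | algebraMap c => rw [← Algebra.smul_def, ← Algebra.smul_def, map_smul]
  | add c c' _ _ hc hc' => rw [add_mul, add_mul, map_add, hc, hc']
  | mul c c' _ _ hc hc' => rw [mul_assoc, mul_assoc, hc, hc']

/-- A `k`-linear operator commuting with the monomials `x^{q n}`, as an `R^q`-linear map. -/
def toPowLinear (φ : Module.End k (FaceRing k K))
    (h : ∀ n : V →₀ ℕ, φ * Algebra.lmul k _ (mono k K (p ^ r • n)) =
      Algebra.lmul k _ (mono k K (p ^ r • n)) * φ) :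
    Module.End (powSubalgebra k (FaceRing k K) (p ^ r)) (FaceRing k K) where
  toFun := φ
  map_add' := map_add φ
  map_smul' c f := map_powSubalgebra_mul h c.2 f

/-- Only the source exponent has to be reduced. The target `b` is arbitrary, which allows shifts
onto `x_σ x^a`. -/
theorem shiftOp_mem_diffOps [DecidableEq V] [Finite V] {hq : p ^ r ≠ 0} {a b : V →₀ ℕ}
    (hab : ∀ ρ : Finset V, IsFace K (b.support ∪ ρ) → IsFace K (a.support ∪ ρ))
    (ha : ∀ i, a i < p ^ r) : shiftOp k hq hab ∈ diffOps k (FaceRing k K) :=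
  restrictScalars_mem_diffOps k p r K (toPowLinear _ (shiftOp_mul_lmul hq hab ha))

end CharP

/-! ### Decomposition into components -/

theorem eq_of_add_smul_eq {q : ℕ} {a b m n : V →₀ ℕ} (ha : ∀ i, a i < q) (hb : ∀ i, b i < q)
    (h : a + q • m = b + q • n) : a = b := by
  ext i
  have h1 := congrArg (· % q) (DFunLike.congr_fun h i)
  simpa [Nat.mod_eq_of_lt (ha i), Nat.mod_eq_of_lt (hb i)] using h1

theorem exists_eq_add_smul {q : ℕ} (hq : q ≠ 0) (m : V →₀ ℕ) :
    ∃ a n : V →₀ ℕ, (∀ i, a i < q) ∧ m = a + q • n := by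
  refine ⟨m.mapRange (· % q) (Nat.zero_mod q), m.mapRange (· / q) (Nat.zero_div q),
    fun i => ?_, ?_⟩
  · simpa using Nat.mod_lt _ (Nat.pos_of_ne_zero hq)
  · ext i
    simpa using (Nat.mod_add_div (m i) q).symm

/-- An operator lies in a two-sided ideal if its restrictions to the spans of the classes of
monomials modulo `q`-th powers, extended by zero, do. -/
theorem mem_of_forall_component [Finite V] [CommRing k] {q : ℕ} (hq : q ≠ 0)
    (I : TwoSidedIdeal (diffOps k (FaceRing k K))) (d : diffOps k (FaceRing k K))
    (h : ∀ a : V →₀ ℕ, (∀ i, a i < q) → ∃ e ∈ I,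
      (∀ n : V →₀ ℕ, (e : Module.End k (FaceRing k K)) (mono k K (a + q • n)) =
        (d : Module.End k (FaceRing k K)) (mono k K (a + q • n))) ∧
      ∀ m : V →₀ ℕ, (∀ n, m ≠ a + q • n) →
        (e : Module.End k (FaceRing k K)) (mono k K m) = 0) : d ∈ I := by
  classical
  choose! e heI he he0 using h
  let s : Finset (V →₀ ℕ) := Finset.Icc 0 (Finsupp.equivFunOnFinite.symm fun _ => q - 1)
  have hs : ∀ a, a ∈ s ↔ ∀ i, a i < q := by
    intro a
    rw [Finset.mem_Icc, and_iff_right (show 0 ≤ a from fun _ => Nat.zero_le _)]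
    refine forall_congr' fun i => ?_
    simp only [Finsupp.coe_equivFunOnFinite_symm]
    omega
  -- Each exponent has a unique residue in the box `s`, so exactly one summand can be non-zero on a
  -- given monomial, and it agrees there with `d`.
  have hd : d = ∑ a ∈ s, e a := by
    refine Subtype.ext (linearMap_ext_mono fun m => ?_)
    obtain ⟨a, n, ha, rfl⟩ := exists_eq_add_smul hq m
    rw [AddSubmonoidClass.coe_finsetSum, LinearMap.sum_apply, Finset.sum_eq_single a, he a ha]
    · intro b hb hba
      exact he0 b ((hs b).1 hb) _ fun l hl => hba (eq_of_add_smul_eq ((hs b).1 hb) ha hl.symm)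
    · exact fun h => absurd ((hs a).2 ha) h
  rw [hd]
  exact sum_mem fun a ha => heI a ((hs a).1 ha)

/-! ### The two inclusions -/

section Inclusions

variable [DecidableEq V] [Finite V] [Field k] {p : ℕ} [Fact p.Prime] [CharP k p] {σ : Finset V}

omit [DecidableEq V] [Finite V] in
theorem mulOp_mono_apply (a b : V →₀ ℕ) :
    (mulOp k (mono k K a) : Module.End k (FaceRing k K)) (mono k K b) = mono k K (a + b) :=
  (mono_add a b).symm

omit [Finite V] in
/-- The projection of `R` onto `R^q x_σ` belongs to `Hom(M_L^q, M_L^q)`, where `L = st(σ)`. -/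
theorem shiftOp_mem_frobIdeal (hσ : IsFace K σ) {r : ℕ} (hr : r ≠ 0) (hq : p ^ r ≠ 0)
    (hd : shiftOp k hq (fun ρ (h : IsFace K ((faceExp σ).support ∪ ρ)) => h) ∈
      diffOps k (FaceRing k K)) :
    (⟨_, hd⟩ : diffOps k (FaceRing k K)) ∈ frobIdeal k K p (star K σ) := by
  -- `r ≠ 0` ensures `p^r > 1`, so that `x_σ` is one of the monomials generating `M_L^q`.
  have hlt : ∀ i, faceExp σ i < p ^ r := fun i =>
    (faceExp_le_one σ i).trans_lt (Nat.one_lt_pow hr (Fact.out : p.Prime).one_lt)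
  set φ := toPowLinear _ (shiftOp_mul_lmul (k := k) hq
    (fun ρ (h : IsFace K ((faceExp σ).support ∪ ρ)) => h) hlt)
  have hφ0 : ∀ a : V →₀ ℕ, (∀ i, a i < p ^ r) → a ≠ faceExp σ → φ (mono k K a) = 0 := by
    intro a ha hne
    refine shiftOp_of_forall_ne hq (fun _ h => h) fun n hn => hne ?_
    exact eq_of_add_smul_eq (m := 0) ha hlt (by simpa using hn)
  have hφ1 : φ (mono k K (faceExp σ)) = mono k K (faceExp σ) := by
    have := shiftOp_add_smul (k := k) hq
      (fun ρ (h : IsFace K ((faceExp σ).support ∪ ρ)) => h) 0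
    rwa [smul_zero, add_zero] at this
  have hmap : ∀ f ∈ frobSummand k K (p ^ r) (star K σ),
      φ f ∈ frobSummand k K (p ^ r) (star K σ) := by
    intro f hf
    refine (Submodule.span_le (p := (frobSummand k K (p ^ r) (star K σ)).comap φ)).2 ?_ hf
    rintro _ ⟨a, ha, hface, hstar, rfl⟩
    change φ (mono k K a) ∈ frobSummand k K (p ^ r) (star K σ)
    by_cases h : a = faceExp σ
    · rw [h, hφ1]
      exact Submodule.subset_span ⟨_, hlt, by rwa [support_faceExp], by rw [support_faceExp], rfl⟩
    · rw [hφ0 a ha h]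
      exact zero_mem _
  refine le_iSup (fun r => frobIdealAt k K (p ^ r) (star K σ) (star K σ)) r
    (TwoSidedIdeal.subset_span ⟨φ, ⟨⟨φ.restrict hmap, fun f => rfl⟩, ?_⟩, rfl⟩)
  intro τ _ hτ f hf
  refine (Submodule.span_le (p := LinearMap.ker φ)).2 ?_ hf
  rintro _ ⟨a, ha, _, hstar, rfl⟩
  refine hφ0 a ha ?_
  rintro rfl
  rw [support_faceExp] at hstar
  exact hτ hstar.symm

/-- Two levels are needed: modulo `p` the exponent must look like that of `x_σ`, while its support
must still record `supp a`. Working modulo `p^2` leaves room for both, with entries of `t` equal to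
`1` on `σ` and `p` on `supp a \ σ`. -/
theorem span_xFace_le_frobIdeal (hσ : IsFace K σ) :
    TwoSidedIdeal.span {mulOp k (xFace k K σ)} ≤ frobIdeal k K p (star K σ) := by
  rw [TwoSidedIdeal.span_le, Set.singleton_subset_iff, xFace_eq_mono]
  have hp := (Fact.out : p.Prime).one_lt
  have hq : p ^ 1 ≠ 0 := by rw [pow_one]; omega
  have hq' : p ^ 2 ≠ 0 := pow_ne_zero _ (by omega)
  have hσq : ∀ i, faceExp σ i < p ^ 1 := fun i => by
    rw [pow_one]
    exact (faceExp_le_one σ i).trans_lt hp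
  refine mem_of_forall_component hq' _ _ fun a ha => ?_
  -- `x^a ↦ x^t ↦ x^t ↦ x_σ x^a`, where `t ≡ σ` modulo `p` and `x^t` has support `supp a ∪ σ`
  set t : V →₀ ℕ := faceExp σ + p ^ 1 • faceExp (a.support \ σ) with ht
  have hts : t.support = a.support ∪ σ := by
    rw [ht, support_add, support_smul hq, support_faceExp, support_faceExp, Finset.union_comm,
      Finset.sdiff_union_self_eq_union]
  have htq : ∀ i, t i < p ^ 2 := by
    intro i
    simp only [ht, pow_one, Finsupp.add_apply, Finsupp.smul_apply, faceExp_apply,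
      Finset.mem_sdiff, smul_eq_mul]
    split_ifs <;> nlinarith
  have h1 : ∀ ρ : Finset V, IsFace K (t.support ∪ ρ) → IsFace K (a.support ∪ ρ) := fun ρ h =>
    h.mono (Finset.union_subset_union_left (by rw [hts]; exact Finset.subset_union_left))
  -- `x^t` and `x_σ x^a` have the same support. If it is not a face, both are zero and the
  -- factorization still holds.
  have h2 : ∀ ρ : Finset V, IsFace K ((faceExp σ + a).support ∪ ρ) → IsFace K (t.support ∪ ρ) := by
    intro ρ h
    rwa [support_add, support_faceExp, Finset.union_comm σ, ← hts] at h
  refine ⟨⟨shiftOp k hq' h2, shiftOp_mem_diffOps h2 htq⟩ *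
    ⟨shiftOp k hq fun ρ h => h, shiftOp_mem_diffOps _ hσq⟩ *
    ⟨shiftOp k hq' h1, shiftOp_mem_diffOps h1 ha⟩,
    TwoSidedIdeal.mul_mem_right _ _ _ (TwoSidedIdeal.mul_mem_left _ _ _
      (shiftOp_mem_frobIdeal hσ one_ne_zero hq _)), fun n => ?_, fun m hm => ?_⟩
  · change shiftOp k hq' h2 (shiftOp k hq (fun _ h => h) (shiftOp k hq' h1 _)) = _
    have e : t + p ^ 2 • n =
        faceExp σ + p ^ 1 • (faceExp (a.support \ σ) + p • n) := by
      rw [ht, smul_add, add_assoc, ← mul_smul, pow_one, sq]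
    rw [shiftOp_add_smul, e, shiftOp_add_smul, ← e, shiftOp_add_smul, mulOp_mono_apply, add_assoc]
  · change shiftOp k hq' h2 (shiftOp k hq (fun _ h => h) (shiftOp k hq' h1 _)) = _
    rw [shiftOp_of_forall_ne hq' h1 hm, map_zero, map_zero]

theorem frobIdeal_le_span_xFace :
    frobIdeal k K p (star K σ) ≤ TwoSidedIdeal.span {mulOp k (xFace k K σ)} := by
  refine iSup_le fun r => ?_
  refine TwoSidedIdeal.span_le.2 ?_
  rintro d ⟨φ, ⟨-, hφ⟩, hd⟩
  have hp := (Fact.out : p.Prime).two_le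
  have hq : p ^ r ≠ 0 := pow_ne_zero _ (by omega)
  have hq' : p ^ (r + 2) ≠ 0 := pow_ne_zero _ (by omega)
  -- The exponent of `x_σ x_{supp a}` has entries up to `2` and must be reduced. Raising the level
  -- by two achieves this even for `p = 2`, `r = 0`.
  have hq2 : 2 < p ^ (r + 2) :=
    calc 2 < 2 ^ 2 := by norm_num
      _ ≤ p ^ 2 := Nat.pow_le_pow_left hp 2
      _ ≤ p ^ (r + 2) := Nat.pow_le_pow_right (by omega) (by omega)
  refine mem_of_forall_component hq' _ _ fun a ha => ?_
  obtain ⟨c, l, hc, hal⟩ := exists_eq_add_smul hq a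
  have hca : c.support ⊆ a.support := by
    rw [hal, support_add]
    exact Finset.subset_union_left
  by_cases hcL : IsFace K c.support ∧ star K c.support = star K σ
  · -- `x^a ↦ x_{supp a} ↦ x_σ x_{supp a} ↦ x^a`
    have h1 : ∀ ρ : Finset V, IsFace K ((faceExp a.support).support ∪ ρ) →
        IsFace K (a.support ∪ ρ) := fun ρ h => by rwa [support_faceExp] at h
    -- The residue `c` has the star of `σ` and its support lies in `supp a`, so `supp a ∪ ρ` remains
    -- a face after adjoining `σ`. This makes the shift back from `x_σ x_{supp a}` to `x^a` well
    -- defined.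
    have h2 : ∀ ρ : Finset V, IsFace K (a.support ∪ ρ) →
        IsFace K ((faceExp σ + faceExp a.support).support ∪ ρ) := by
      intro ρ h
      have := isFace_union_of_star_eq hcL.2 (hca.trans Finset.subset_union_left) h
      rwa [support_add, support_faceExp, support_faceExp, Finset.union_assoc, Finset.union_comm]
    have hu : ∀ i, (faceExp σ + faceExp a.support) i < p ^ (r + 2) := fun i =>
      (add_le_add (faceExp_le_one σ i) (faceExp_le_one a.support i)).trans_lt hq2
    refine ⟨d * (⟨shiftOp k hq' h2, shiftOp_mem_diffOps h2 hu⟩ * mulOp k (xFace k K σ) *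
      ⟨shiftOp k hq' h1, shiftOp_mem_diffOps h1 ha⟩),
      TwoSidedIdeal.mul_mem_left _ _ _ (TwoSidedIdeal.mul_mem_right _ _ _
        (TwoSidedIdeal.mul_mem_left _ _ _ (TwoSidedIdeal.subset_span rfl))),
      fun n => ?_, fun m hm => ?_⟩
    · change d.1 (shiftOp k hq' h2 ((mulOp k (xFace k K σ)).1 (shiftOp k hq' h1 _))) = d.1 _
      rw [shiftOp_add_smul, xFace_eq_mono, mulOp_mono_apply, ← add_assoc, shiftOp_add_smul]
    · change d.1 (shiftOp k hq' h2 ((mulOp k (xFace k K σ)).1 (shiftOp k hq' h1 _))) = 0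
      rw [shiftOp_of_forall_ne hq' h1 hm, map_zero, map_zero, map_zero]
  -- Here `d` kills the whole component: its monomials are zero if `supp c` is not a face, and
  -- otherwise they lie in the summand of a star different from `st(σ)`.
  · refine ⟨0, TwoSidedIdeal.zero_mem _, fun n => ?_, fun m _ => rfl⟩
    change 0 = d.1 _
    by_cases hface : IsFace K c.support
    · have e : mono k K (a + p ^ (r + 2) • n) =
          mono k K (l + p ^ 2 • n) ^ p ^ r * mono k K c := by
        rw [← mono_smul, ← mono_add, hal, smul_add, ← mul_smul, ← pow_add]
        congr 1
        abel
      have hmem : mono k K (a + p ^ (r + 2) • n) ∈ frobSummand k K (p ^ r) (star K c.support) := by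
        rw [e]
        exact Submodule.smul_mem _ (⟨_, Algebra.subset_adjoin ⟨_, rfl⟩⟩ :
          powSubalgebra k (FaceRing k K) (p ^ r)) (Submodule.subset_span ⟨c, hc, hface, rfl, rfl⟩)
      rw [show d.1 = LinearMap.restrictScalars k φ from hd]
      exact (hφ c.support hface (fun h => hcL ⟨hface, h⟩) _ hmem).symm
    · rw [mono_eq_zero, map_zero]
      intro h
      refine hface (h.mono (hca.trans ?_))
      rw [support_add]
      exact Finset.subset_union_left

end Inclusions

end

end StanleyReisner

/-- `J(st(σ)) = ⟨x_σ⟩` for every face `σ` of a finite simplicial complex, over any field of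
characteristic `p > 0`. -/
theorem mainTheorem10 {V : Type*} [Finite V] [DecidableEq V]
    (K : PreAbstractSimplicialComplex V) (k : Type*) [Field k] (p : ℕ) [Fact p.Prime] [CharP k p]
    (σ : Finset V) (hσ : StanleyReisner.IsFace K σ) :
    StanleyReisner.frobIdeal k K p (StanleyReisner.star K σ) =
      TwoSidedIdeal.span
        {StanleyReisner.mulOp k (StanleyReisner.xFace k K σ)} := by
  exact le_antisymm StanleyReisner.frobIdeal_le_span_xFace
    (StanleyReisner.span_xFace_le_frobIdeal hσ)
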